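/- Let $K$ be a field. All curves are understood to be geometrically integral: a curve over $K$ is a separated $K$-scheme of finite type that is geometrically integral (geometrically irreducible and geometrically reduced) and of dimension $1$. The field $K$ is called ample if every smooth curve over $K$ that has a $K$-rational point has infinitely many $K$-rational points. Theorem. Let $K$ be an ample field, let $C$ be a curve over $K$ with a simple (i.e. smooth) $K$-rational point, let $C'\subseteq\mathbb{A}^n_K$ be an affine curve over $K$ (a closed subscheme of affine $n$-space which is a curve), and let $\varphi\colon C\dashrightarrow C'$ be a dominant $K$-rational map which is separable, i.e. the induced extension of function fields $K(C)/K(C')$ is separable. Let $\varphi(C(K))\subseteq C'(K)\subseteq\mathbb{A}^n(K)=K^n$ denote the set of values of $\varphi$ at those points of $C(K)$ at which $\varphi$ is defined. Then for every proper subfield $K_0$ of $K$, $$|\varphi(C(K))\smallsetminus\mathbb{A}^n(K_0)|=|K|,$$ where $\mathbb{A}^n(K_0)=K_0^n\subseteq K^n$. -/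

import Mathlib

open CategoryTheory AlgebraicGeometry

universe u

noncomputable section

namespace AmpleFields

/-- The `K`-rational points of a `K`-scheme `X`, i.e. the sections of `X ⟶ Spec K`. -/
def RationalPoint (K : Type u) [Field K] (X : Scheme.{u}) [X.Over (Spec (.of K))] : Type u :=
  { P : Spec (.of K) ⟶ X // P ≫ (X ↘ Spec (.of K)) = 𝟙 (Spec (.of K)) }

/-- A curve over `K`: a geometrically integral separated `K`-scheme of finite type which has
dimension one. -/
class IsCurve (K : Type u) [Field K] (C : Scheme.{u}) [C.Over (Spec (.of K))] : Prop where
  isSeparated : IsSeparated (C ↘ Spec (.of K))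
  locallyOfFiniteType : LocallyOfFiniteType (C ↘ Spec (.of K))
  quasiCompact : QuasiCompact (C ↘ Spec (.of K))
  geometricallyIntegral : GeometricallyIntegral (C ↘ Spec (.of K))
  dimension_eq_one : topologicalKrullDim C = 1

/-- A curve is integral, so that its function field makes sense. -/
theorem IsCurve.isIntegral (K : Type u) [Field K] (C : Scheme.{u}) [C.Over (Spec (.of K))]
    [hC : IsCurve K C] : IsIntegral C := by
  have := hC.geometricallyIntegral
  exact GeometricallyIntegral.isIntegral_of_subsingleton (C ↘ Spec (.of K))

/-- A `K`-rational point of `X` is simple if `X` is smooth over `K` in a neighbourhood of it. -/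
def RationalPoint.IsSimple {K : Type u} [Field K] {X : Scheme.{u}} [X.Over (Spec (.of K))]
    (P : RationalPoint K X) : Prop :=
  ∃ U : X.Opens, P.1 (IsLocalRing.closedPoint K) ∈ U ∧ Smooth (U.ι ≫ (X ↘ Spec (.of K)))

/-- A field `K` is ample if every smooth curve over `K` with a `K`-rational point has infinitely
many `K`-rational points. -/
def IsAmple (K : Type u) [Field K] : Prop :=
  ∀ (C : Scheme.{u}) [C.Over (Spec (.of K))], IsCurve K C → Smooth (C ↘ Spec (.of K)) →
    Nonempty (RationalPoint K C) → Infinite (RationalPoint K C)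

/-- The generic point of the source of a dominant rational map is sent to the generic point of the
target. -/
theorem fromFunctionField_specializes {X Y : Scheme.{u}} [IsIntegral X] [IsIntegral Y]
    (φ : Scheme.RationalMap X Y) [φ.IsDominant] :
    φ.fromFunctionField (IsLocalRing.closedPoint X.functionField) ⤳ genericPoint Y := by
  obtain ⟨f, rfl⟩ := Scheme.PartialMap.toRationalMap_surjective φ
  have : IsDominant f.hom := (f.isDominant_toRationalMap_iff).1 inferInstance
  have hη : genericPoint X ∈ f.domain :=
    (genericPoint_specializes _).mem_open f.domain.2 f.dense_domain.nonempty.choose_spec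
  have hy : f.domain.ι (f.domain.fromSpecStalkOfMem _ hη
      (IsLocalRing.closedPoint X.functionField)) = genericPoint X := by
    have h := congrArg (fun g : Spec (X.presheaf.stalk (genericPoint X)) ⟶ X =>
      g (IsLocalRing.closedPoint (X.presheaf.stalk (genericPoint X))))
      (Scheme.Opens.fromSpecStalkOfMem_ι f.domain _ hη)
    exact h.trans Scheme.fromSpecStalk_closedPoint
  have hφ : f.toRationalMap.fromFunctionField (IsLocalRing.closedPoint X.functionField) =
      f.hom (f.domain.fromSpecStalkOfMem _ hη (IsLocalRing.closedPoint X.functionField)) := rfl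
  rw [hφ, specializes_iff_mem_closure]
  have hr : Set.range f.hom ⊆ closure {f.hom (f.domain.fromSpecStalkOfMem _ hη
      (IsLocalRing.closedPoint X.functionField))} := by
    rintro _ ⟨z, rfl⟩
    refine specializes_iff_mem_closure.1 (Specializes.map ?_ f.hom.continuous)
    rw [← f.domain.ι.isOpenEmbedding.isInducing.specializes_iff, hy]
    exact genericPoint_specializes _
  exact closure_minimal hr isClosed_closure (f.hom.denseRange _)

/-- The homomorphism `K(Y) ⟶ K(X)` of function fields which is induced by a dominant rational map
from `X` to `Y`. -/
def functionFieldMap {X Y : Scheme.{u}} [IsIntegral X] [IsIntegral Y]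
    (φ : Scheme.RationalMap X Y) [φ.IsDominant] : Y.functionField ⟶ X.functionField :=
  Y.presheaf.stalkSpecializes (fromFunctionField_specializes φ) ≫
    Scheme.stalkClosedPointTo φ.fromFunctionField

/-- A dominant rational map `φ` between curves over `K` is separable if the extension of function
fields that it induces is separable. -/
def IsSeparableMap (K : Type u) [Field K] {C C' : Scheme.{u}} [C.Over (Spec (.of K))]
    [C'.Over (Spec (.of K))] [IsCurve K C] [IsCurve K C']
    (φ : Scheme.RationalMap C C') [φ.IsDominant] : Prop :=
  haveI := IsCurve.isIntegral K C
  haveI := IsCurve.isIntegral K C'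
  letI : Algebra C'.functionField C.functionField := (functionFieldMap φ).hom.toAlgebra
  Algebra.IsSeparable C'.functionField C.functionField

/-- The set `φ(X(K)) ⊆ Y(K)` of the values of a rational map `φ` at those `K`-rational points
of `X` at which it is defined, i.e. which lie in the domain of some representative `g` of `φ`. -/
def imageOfRationalPoints (K : Type u) [Field K] {X Y : Scheme.{u}} [X.Over (Spec (.of K))]
    [Y.Over (Spec (.of K))] (φ : Scheme.RationalMap X Y) : Set (RationalPoint K Y) :=
  { R | ∃ (P : RationalPoint K X) (g : X.PartialMap Y) (Q : Spec (.of K) ⟶ g.domain.toScheme),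
      g.toRationalMap = φ ∧ Q ≫ g.domain.ι = P.1 ∧ Q ≫ g.hom = R.1 }

/-- Affine `n`-space over `K`. -/
abbrev affineSpace (n : ℕ) (K : Type u) [Field K] : Scheme.{u} :=
  AffineSpace (ULift.{u} (Fin n)) (Spec (.of K))

/-- The coordinates in `Kⁿ` of a morphism from `Spec K` to affine `n`-space. -/
def coordinates {n : ℕ} {K : Type u} [Field K] (P : Spec (.of K) ⟶ affineSpace n K) :
    Fin n → K :=
  fun j => (Scheme.ΓSpecIso (.of K)).hom (P.appTop (AffineSpace.coord (Spec (.of K)) ⟨j⟩))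

end AmpleFields

end

/-! The cardinality comes from ratios. Let `V ⊆ K` be the set of values of an étale coordinate at
rational points, and let `a ∈ V`. The set of `t` with `a + c * t ∈ V` contains the image of an étale
neighbourhood of `0` in the affine line, and fibre products intersect such neighbourhoods. By
ampleness each of them has a point with `t ≠ 0` (`exists_point_ne_zero`). So every `b ≠ 0` is a
ratio `(y - a) / (x - a)` with `x, y ∈ V`, whence `#K ≤ #V`. If `K₀` is as large as `K` and `a ∈
K₀`, an auxiliary `c ∉ K₀` makes it possible to take `x, y` outside `K₀` for every nonzero `b ∈ K₀`
(`mk_le_mk_coordinateValues_diff`).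

To apply ampleness, an étale neighbourhood must be shrunk to a curve: its ring maps to `K⟦X⟧`,
injectively after a localization, and subalgebras of `K⟦X⟧` are geometrically integral.

The theorem reduces to this case because separability makes the differentials of the coordinates of
`φ` span those of `K(C)`. A basis chosen among them is étale at the generic point, and dimension one
forces it to be a single coordinate (`exists_etale_localizationAway`). A value whose chosen
coordinate avoids `K₀` lies outside `K₀ⁿ`. -/

noncomputable section

namespace AmpleFields

section CommutativeAlgebra

open Polynomial TensorProduct

/-! ### Étale algebras over `K[X]` at a rational point above the origin. -/

section EtalePoint

variable {K : Type u} [Field K] {B : Type u} [CommRing B] [Algebra K[X] B]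

/-- An unramified algebra over a field is von Neumann regular. -/
theorem exists_mul_one_sub_mul_eq_zero {Q : Type u} [CommRing Q] [Algebra K Q]
    [Algebra.FormallyUnramified K Q] [Algebra.EssFiniteType K Q] (f : Q) :
    ∃ y : Q, f * (1 - f * y) = 0 := by
  have : Module.Finite K Q := Algebra.FormallyUnramified.finite_of_free K Q
  have : IsArtinianRing Q := IsArtinianRing.of_finite K Q
  have : IsReduced Q := Algebra.FormallyUnramified.isReduced_of_field K Q
  obtain ⟨n, y, hy⟩ := IsArtinian.exists_pow_succ_smul_dvd f (1 : Q)
  refine ⟨y, ?_⟩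
  have h : f ^ n * (1 - f * y) = 0 := by
    simp only [smul_eq_mul, mul_one, Nat.succ_eq_add_one, pow_succ] at hy
    linear_combination -hy
  apply IsReduced.eq_zero
  refine ⟨n + 1, ?_⟩
  rw [mul_pow, pow_succ f, pow_succ (1 - f * y)]
  linear_combination f * (1 - f * y)^n * h

/-- `X` is a local parameter at the point `e`: the fibre `B / (X)` is unramified over `K`, hence von
Neumann regular, and `s = 1 - f * y` with `y` a quasi-inverse of `f` there. -/
theorem exists_mul_eq_algebraMap_X_mul [Algebra.Etale K[X] B] (e : B →+* K)
    (f : B) (hf : e f = 0) :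
    ∃ s g : B, e s = 1 ∧ s * f = algebraMap K[X] B X * g := by
  let Q := B ⧸ Ideal.span {algebraMap K[X] B X}
  let : Algebra K Q := ((algebraMap K[X] Q).comp C).toAlgebra
  let : Algebra K[X] K := (evalRingHom (0 : K)).toAlgebra
  have : IsScalarTower K[X] K Q := by
    refine IsScalarTower.of_algebraMap_eq fun p ↦ ?_
    change _ = algebraMap K[X] Q (C (eval 0 p))
    rw [← sub_eq_zero, ← map_sub]
    obtain ⟨q, hq⟩ : X ∣ p - C (eval 0 p) := by
      rw [X_dvd_iff]; simp [coeff_zero_eq_eval_zero]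
    rw [hq, map_mul, IsScalarTower.algebraMap_apply K[X] B Q X]
    have : algebraMap B Q (algebraMap K[X] B X) = 0 :=
      Ideal.Quotient.eq_zero_iff_mem.2 (Ideal.mem_span_singleton_self _)
    rw [this, zero_mul]
  have : Algebra.FormallyUnramified K[X] Q := Algebra.FormallyUnramified.quotient _
  have : Algebra.FormallyUnramified K Q := Algebra.FormallyUnramified.of_restrictScalars K[X] K Q
  have : Algebra.FiniteType K[X] Q := inferInstance
  have : Algebra.FiniteType K Q := Algebra.FiniteType.of_restrictScalars_finiteType K[X] K Q
  obtain ⟨y, hy⟩ := exists_mul_one_sub_mul_eq_zero (K := K) (Ideal.Quotient.mk _ f : Q)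
  obtain ⟨y, rfl⟩ := Ideal.Quotient.mk_surjective y
  have h : (Ideal.Quotient.mk _ (f * (1 - f * y)) : Q) = 0 := by simpa using hy
  rw [Ideal.Quotient.eq_zero_iff_mem, Ideal.mem_span_singleton] at h
  obtain ⟨g, hg⟩ := h
  exact ⟨1 - f * y, g, by simp [hf], by rw [mul_comm, hg]⟩

/-- Taylor expansion at the point: `e` is a map to `K⟦X⟧ / (X)`, lifted by formal smoothness along
the `X`-adic topology. -/
theorem exists_algHom_powerSeries [Algebra.FormallySmooth K[X] B] (e : B →+* K)
    (he : e.comp (algebraMap K[X] B) = evalRingHom 0) :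
    ∃ ψ : B →ₐ[K[X]] PowerSeries K, ∀ b, PowerSeries.constantCoeff (ψ b) = e b := by
  let I : Ideal (PowerSeries K) := Ideal.span {PowerSeries.X}
  let f : B →ₐ[K[X]] PowerSeries K ⧸ I :=
    { ((Ideal.Quotient.mk I).comp PowerSeries.C).comp e with
      commutes' := fun p ↦ by
        have : e (algebraMap K[X] B p) = eval 0 p := congr($he p)
        change Ideal.Quotient.mk I (PowerSeries.C (e (algebraMap K[X] B p))) =
          Ideal.Quotient.mk I (algebraMap K[X] (PowerSeries K) p)
        rw [this, Ideal.Quotient.eq, Ideal.mem_span_singleton, PowerSeries.X_dvd_iff]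
        simp [PowerSeries.algebraMap_apply', ← coeff_zero_eq_eval_zero] }
  obtain ⟨ψ, hψ⟩ := Algebra.FormallySmooth.exists_mkₐ_comp_eq_of_isAdicComplete f
  refine ⟨ψ, fun b ↦ ?_⟩
  have h : Ideal.Quotient.mk I (ψ b) = Ideal.Quotient.mk I (PowerSeries.C (e b)) := congr($hψ b)
  rw [Ideal.Quotient.eq, Ideal.mem_span_singleton, PowerSeries.X_dvd_iff] at h
  simpa [sub_eq_zero] using h

/-- The local ring of an étale `K[X]`-algebra at a rational point over `0` embeds into `K⟦X⟧`. -/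
theorem exists_localizationAway_injective [Algebra.Etale K[X] B] (e : B →+* K)
    (he : e.comp (algebraMap K[X] B) = evalRingHom 0) :
    ∃ r : B, e r = 1 ∧ ∃ ψ : Localization.Away r →ₐ[K[X]] PowerSeries K,
      Function.Injective ψ ∧ ∀ b, PowerSeries.constantCoeff (ψ (algebraMap B _ b)) = e b := by
  obtain ⟨ψ, hψ⟩ := exists_algHom_powerSeries e he
  have : IsNoetherianRing B := Algebra.FiniteType.isNoetherianRing K[X] B
  have ht : e (algebraMap K[X] B X) = 0 := by simpa using congr($he X)
  -- Nakayama's lemma will make the kernel vanish near `e`. If `s * f = X * g` with `ψ f = 0`, then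
  -- `ψ g = 0` as `K⟦X⟧` is a domain, and `f = (1 - s) * f + X * g`.
  have key : RingHom.ker ψ ≤ RingHom.ker e • RingHom.ker ψ := by
    intro f hf
    have hf' : ψ f = 0 := hf
    obtain ⟨s, g, hs, hg⟩ := exists_mul_eq_algebraMap_X_mul e f (by rw [← hψ, hf', map_zero])
    have hg' : ψ g = 0 := by
      have h := congr(ψ $hg)
      rw [map_mul, hf', mul_zero, map_mul, AlgHom.commutes] at h
      refine (mul_eq_zero.1 h.symm).resolve_left ?_
      rw [PowerSeries.algebraMap_apply']
      simp [PowerSeries.X_ne_zero]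
    have : f = (1 - s) • f + algebraMap K[X] B X • g := by
      simp only [smul_eq_mul]; linear_combination hg
    rw [this]
    exact add_mem (Submodule.smul_mem_smul (by simp [RingHom.mem_ker, hs]) hf)
      (Submodule.smul_mem_smul (by simpa [RingHom.mem_ker] using ht) hg')
  obtain ⟨r, hr, hr'⟩ := Submodule.exists_sub_one_mem_and_smul_eq_zero_of_fg_of_le_smul _ _
    (IsNoetherian.noetherian (RingHom.ker ψ)) key
  have her : e r = 1 := by
    rw [RingHom.mem_ker, map_sub, map_one, sub_eq_zero] at hr; exact hr
  have hu : IsUnit (ψ r) := by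
    rw [PowerSeries.isUnit_iff_constantCoeff, hψ, her]; exact isUnit_one
  let Ψ : Localization.Away r →ₐ[K[X]] PowerSeries K :=
    IsLocalization.liftAlgHom (M := Submonoid.powers r) (f := ψ) (by
      rintro ⟨_, n, rfl⟩; rw [map_pow]; exact hu.pow n)
  have hΨ (b : B) : Ψ (algebraMap B _ b) = ψ b := by simp [Ψ]
  refine ⟨r, her, Ψ, ?_, fun b ↦ by rw [hΨ, hψ]⟩
  rw [injective_iff_map_eq_zero]
  intro x hx
  obtain ⟨b, s, rfl⟩ := IsLocalization.exists_mk'_eq (Submonoid.powers r) x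
  have h1 : ψ b = 0 := by
    rw [← hΨ, ← IsLocalization.mk'_spec (Localization.Away r) b s, map_mul, hx, zero_mul]
  rw [IsLocalization.mk'_eq_zero_iff]
  exact ⟨⟨r, Submonoid.mem_powers r⟩, hr' b h1⟩

end EtalePoint

/-! ### Geometric integrality of subalgebras of `K⟦X⟧`. -/

section TensorDomain

variable {K : Type u} [Field K] {A : Type u} [CommRing A] [Algebra K A]
  (L : Type u) [Field L] [Algebra K L]

open Classical in
/-- A subalgebra of `K⟦X⟧` stays a domain under extension of the field of constants. -/
theorem isDomain_tensorProduct_of_injective_powerSeries (ψ : A →ₐ[K] PowerSeries K)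
    (hψ : Function.Injective ψ) : IsDomain (L ⊗[K] A) := by
  let μ : L ⊗[K] PowerSeries K →ₐ[K] PowerSeries L :=
    Algebra.TensorProduct.lift (IsScalarTower.toAlgHom K L (PowerSeries L))
      (PowerSeries.mapAlgHom (Algebra.ofId K L)) (fun _ _ ↦ Commute.all _ _)
  have hμ : Function.Injective μ := by
    -- Write a tensor as `∑ b i ⊗ c i` in a `K`-basis of `L`; each coefficient of its image is a
    -- `K`-linear relation between the `b i`.
    let b := Module.Basis.ofVectorSpace K L
    let E := TensorProduct.equivFinsuppOfBasisLeft (N := PowerSeries K) b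
    rw [injective_iff_map_eq_zero]
    intro x hx
    obtain ⟨c, rfl⟩ := E.symm.surjective x
    have hE : E.symm c = c.sum fun i m ↦ b i ⊗ₜ m := by
      simp [E]
    rw [hE] at hx ⊢
    have hc : c = 0 := by
      ext i n
      have h1 := congr(PowerSeries.coeff n $hx)
      have h2 : ∑ i ∈ c.support, (PowerSeries.coeff n (c i)) • b i = 0 := by
        rw [← map_zero (PowerSeries.coeff (R := L) n), ← h1, Finsupp.sum, map_sum, map_sum]
        refine Finset.sum_congr rfl fun j _ ↦ ?_
        have h3 : PowerSeries.mapAlgHom (Algebra.ofId K L) (c j) =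
          PowerSeries.map (algebraMap K L) (c j) := rfl
        simp [μ, Algebra.smul_def, mul_comm, h3]
      by_cases hi : i ∈ c.support
      · simpa using linearIndependent_iff'.1 b.linearIndependent _ _ h2 i hi
      · simp [Finsupp.notMem_support_iff.1 hi]
    simp [hc]
  have h1 : Function.Injective (Algebra.TensorProduct.map (AlgHom.id K L) ψ) :=
    Module.Flat.lTensor_preserves_injective_linearMap (M := L) ψ.toLinearMap hψ
  exact (hμ.comp h1).isDomain (μ.toRingHom.comp
    (Algebra.TensorProduct.map (AlgHom.id K L) ψ).toRingHom)

end TensorDomain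

/-! ### Rational points of affine curves. -/

section AffineCurve

variable {K : Type u} [Field K] {A : Type u} [CommRing A] [Algebra K A]

/-- In a one-dimensional domain of finite type a nonzero element has only finitely many rational
zeros. -/
theorem finite_algHom_apply_eq_zero [IsDomain A] [Ring.KrullDimLE 1 A] [Algebra.FiniteType K A]
    {f : A} (hf : f ≠ 0) : {e : A →ₐ[K] K | e f = 0}.Finite := by
  have : IsNoetherianRing A := Algebra.FiniteType.isNoetherianRing K A
  have hfin := Ideal.finite_minimalPrimes_of_isNoetherianRing A (Ideal.span {f})
  -- In dimension at most one, primes containing `f ≠ 0` are maximal, so the kernels are minimal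
  -- over `(f)`; a rational point is determined by its kernel.
  refine Set.Finite.of_injOn (f := fun e : A →ₐ[K] K ↦ RingHom.ker e) ?_ ?_ hfin
  · intro e he
    refine ⟨⟨RingHom.ker_isPrime _, ?_⟩, ?_⟩
    · rw [Ideal.span_singleton_le_iff_mem]; exact he
    · rintro p ⟨hp, hfp⟩ hle
      have hfp' : f ∈ p := by rwa [Ideal.span_singleton_le_iff_mem] at hfp
      have hmax : p.IsMaximal :=
        hp.isMaximal_of_ne_bot (by rintro rfl; exact hf (by simpa using hfp'))
      exact (hmax.eq_of_le (RingHom.ker_ne_top _) hle).ge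
  · intro e _ e' _ h
    ext a
    have h1 : a - algebraMap K A (e a) ∈ RingHom.ker e := by simp [RingHom.mem_ker]
    rw [show RingHom.ker e = RingHom.ker e' from h] at h1
    exact (sub_eq_zero.1 (by simpa [RingHom.mem_ker] using h1)).symm

theorem infinite_algHom_of_isAmple (hK : IsAmple K) [Algebra.Smooth K A]
    (hA : GeometricallyIntegral (Spec.map (CommRingCat.ofHom (algebraMap K A))))
    (hdim : ringKrullDim A = 1) (e : A →ₐ[K] K) : Infinite (A →ₐ[K] K) := by
  let : (Spec (.of A)).Over (Spec (.of K)) := ⟨Spec.map (CommRingCat.ofHom (algebraMap K A))⟩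
  have hs : Smooth (Spec (.of A) ↘ Spec (.of K)) :=
    HasRingHomProperty.Spec_iff.mpr (RingHom.smooth_algebraMap.mpr inferInstance)
  have hcurve : IsCurve K (Spec (.of A)) :=
    { isSeparated := inferInstanceAs (IsSeparated (Spec.map _))
      locallyOfFiniteType := inferInstance
      quasiCompact := inferInstanceAs (QuasiCompact (Spec.map _))
      geometricallyIntegral := hA
      dimension_eq_one := (PrimeSpectrum.topologicalKrullDim_eq_ringKrullDim A).trans hdim }
  have hinf := hK (Spec (.of A)) hcurve hs
    ⟨⟨Spec.map (CommRingCat.ofHom e.toRingHom), by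
      change Spec.map _ ≫ Spec.map _ = _
      rw [← Spec.map_comp, ← CommRingCat.ofHom_comp]
      have : e.toRingHom.comp (algebraMap K A) = RingHom.id K := e.comp_algebraMap
      rw [this]; simp⟩⟩
  let F : RationalPoint K (Spec (.of A)) → (A →ₐ[K] K) := fun P ↦
    { (Spec.preimage P.1).hom with
      commutes' := fun c ↦ by
        have h : Spec.map (Spec.preimage P.1) ≫
            Spec.map (CommRingCat.ofHom (algebraMap K A)) = 𝟙 _ := by
          rw [Spec.map_preimage]; exact P.2
        have h := (Spec.map_comp _ _).trans (h.trans (Spec.map_id _).symm)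
        exact congr($(congrArg CommRingCat.Hom.hom (Spec.map_injective h)) c) }
  refine Infinite.of_injective F fun P Q h ↦ Subtype.ext ?_
  rw [← Spec.map_preimage P.1, ← Spec.map_preimage Q.1]
  congr 1
  ext a
  exact congr($h a)

theorem geometricallyIntegral_of_isDomain
    (h : ∀ (L : Type u) [Field L] [Algebra K L], IsDomain (L ⊗[K] A)) :
    GeometricallyIntegral (Spec.map (CommRingCat.ofHom (algebraMap K A))) := by
  refine ⟨geometrically_iff_of_commRing.mpr fun L _ _ Y fst snd hY ↦ ?_⟩
  have := h L
  have e := hY.flip.isoPullback ≪≫ pullbackSpecIso K L A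
  have : IsIntegral (Spec (.of (L ⊗[K] A))) := inferInstance
  have : Nonempty Y := ⟨e.inv (Classical.arbitrary _)⟩
  exact isIntegral_of_isOpenImmersion e.hom

end AffineCurve

/-! ### Étale neighbourhoods of the origin over an ample field. -/

section EtaleCurve

variable {K : Type u} [Field K] {A : Type u} [CommRing A] [Algebra K[X] A]

/-- Étale algebras are quasi-finite, so comparable primes with the same contraction coincide, and
nonzero primes contract to maximal ideals of `K[X]`. -/
theorem krullDimLE_one_of_etale [IsDomain A] [Algebra.Etale K[X] A] : Ring.KrullDimLE 1 A := by
  refine Ring.KrullDimLE.mk₁' fun I hI hI' ↦ ?_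
  have hinj : Function.Injective (algebraMap K[X] A) := FaithfulSMul.algebraMap_injective _ _
  obtain ⟨M, hM, hle⟩ := Ideal.exists_le_maximal I hI'.ne_top
  have h0 : I.under K[X] ≠ ⊥ := fun h ↦ hI
    (Algebra.QuasiFinite.eq_of_le_of_under_eq (R := K[X]) ⊥ I bot_le (by
      rw [h]; exact RingHom.ker_eq_bot_iff_eq_zero _ |>.2 (by simp))).symm
  have h1 : (I.under K[X]).IsMaximal := (inferInstance : (I.under K[X]).IsPrime).isMaximal h0
  have h2 : I.under K[X] = M.under K[X] :=
    h1.eq_of_le (inferInstance : (M.under K[X]).IsPrime).ne_top (Ideal.comap_mono hle)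
  rw [Algebra.QuasiFinite.eq_of_le_of_under_eq I M hle h2]
  exact hM

/-- Over an ample field, an étale neighbourhood of the origin of the affine line has a rational
point away from the origin. -/
theorem exists_point_ne_zero (hK : IsAmple K) {B : Type u} [CommRing B] [Algebra K[X] B]
    [Algebra.Etale K[X] B] (e : B →+* K) (he : e.comp (algebraMap K[X] B) = evalRingHom 0) :
    ∃ s : K, s ≠ 0 ∧ ∃ e' : B →+* K, e'.comp (algebraMap K[X] B) = evalRingHom s := by
  obtain ⟨r, her, ψ, hψ, hψe⟩ := exists_localizationAway_injective e he
  let : Algebra K B := ((algebraMap K[X] B).comp C).toAlgebra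
  have : IsScalarTower K K[X] B := .of_algebraMap_eq fun _ ↦ rfl
  let A := Localization.Away r
  have : IsScalarTower K K[X] A := inferInstance
  have : IsScalarTower K K[X] (PowerSeries K) := .of_algebraMap_eq fun x ↦ by
    simp [PowerSeries.algebraMap_apply']
  have : IsDomain A := hψ.isDomain ψ.toRingHom
  have : Algebra.Etale K[X] A := inferInstance
  have : Algebra.Smooth K K[X] := {}
  have : Algebra.Smooth K A := Algebra.Smooth.comp K K[X] A
  have : Ring.KrullDimLE 1 A := krullDimLE_one_of_etale (K := K)
  let ε : A →ₐ[K] K := { (PowerSeries.constantCoeff.comp ψ.toRingHom) with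
    commutes' := fun c ↦ by
      change PowerSeries.constantCoeff (ψ (algebraMap K A c)) = c
      rw [IsScalarTower.algebraMap_apply K K[X] A, AlgHom.commutes,
        PowerSeries.algebraMap_apply']
      simp }
  have ht : algebraMap K[X] A X ≠ 0 := by
    rw [Ne, ← map_eq_zero_iff ψ hψ, AlgHom.commutes, PowerSeries.algebraMap_apply']
    simp [PowerSeries.X_ne_zero]
  have hεt : ε (algebraMap K[X] A X) = 0 := by
    change PowerSeries.constantCoeff (ψ _) = 0
    rw [AlgHom.commutes, PowerSeries.algebraMap_apply']
    simp
  have hdim : ringKrullDim A = 1 := by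
    refine le_antisymm ((Ring.krullDimLE_iff (n := 1)).1 inferInstance) ?_
    -- In dimension zero `A` would be a field, and the kernel of `ε` could not contain the nonzero
    -- image of `X`.
    by_contra hlt
    have : Ring.KrullDimLE 0 A := by
      rw [Ring.krullDimLE_iff]
      exact ENat.WithBot.lt_add_one_iff.mp (not_le.mp hlt)
    have hb : (⊥ : Ideal A).IsMaximal := Ideal.isMaximal_of_isPrime _
    have := hb.eq_of_le (RingHom.ker_ne_top ε.toRingHom) bot_le
    have hmem : algebraMap K[X] A X ∈ RingHom.ker ε.toRingHom := hεt
    exact ht (by rwa [← this, Ideal.mem_bot] at hmem)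
  have hinf := infinite_algHom_of_isAmple hK (geometricallyIntegral_of_isDomain fun L _ _ ↦
    isDomain_tensorProduct_of_injective_powerSeries L (ψ.restrictScalars K) hψ) hdim ε
  obtain ⟨e', he'⟩ := (finite_algHom_apply_eq_zero (K := K) ht).infinite_compl.nonempty
  refine ⟨e' (algebraMap K[X] A X), he', e'.toRingHom.comp (algebraMap B A), ?_⟩
  refine Polynomial.ringHom_ext (fun c ↦ ?_) ?_
  · simp only [RingHom.comp_apply, ← IsScalarTower.algebraMap_apply K[X] B A]
    rw [← Polynomial.algebraMap_eq, ← IsScalarTower.algebraMap_apply K K[X] A]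
    simp
  · simp [← IsScalarTower.algebraMap_apply K[X] B A]

end EtaleCurve

/-! ### Counting the values of an étale coordinate. -/

section Large

variable {K : Type u} [Field K]

/-- A subset of `K` which contains the image of the rational points of some étale neighbourhood
of the origin of the affine line. -/
def ContainsEtaleNeighborhood (S : Set K) : Prop :=
  ∃ (B : Type u) (_ : CommRing B) (_ : Algebra K[X] B), Algebra.Etale K[X] B ∧
    (∃ e : B →+* K, e.comp (algebraMap K[X] B) = evalRingHom 0) ∧
    ∀ (s : K) (e : B →+* K), e.comp (algebraMap K[X] B) = evalRingHom s → s ∈ S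

theorem ContainsEtaleNeighborhood.exists_ne_zero (hK : IsAmple K) {S : Set K}
    (hS : ContainsEtaleNeighborhood S) : ∃ s ∈ S, s ≠ 0 := by
  obtain ⟨B, _, _, _, ⟨e, he⟩, h⟩ := hS
  obtain ⟨s, hs, e', he'⟩ := exists_point_ne_zero hK e he
  exact ⟨s, h s e' he', hs⟩

/-- The witness is the fibre product over the affine line; its two projections place each parameter
in both sets. -/
theorem ContainsEtaleNeighborhood.inter {S T : Set K} (hS : ContainsEtaleNeighborhood S)
    (hT : ContainsEtaleNeighborhood T) : ContainsEtaleNeighborhood (S ∩ T) := by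
  obtain ⟨B, _, _, _, ⟨e, he⟩, h⟩ := hS
  obtain ⟨B', _, _, _, ⟨e', he'⟩, h'⟩ := hT
  refine ⟨B ⊗[K[X]] B', inferInstance, inferInstance, Algebra.Etale.comp K[X] B _, ?_, ?_⟩
  · let : Algebra K[X] K := (evalRingHom (0 : K)).toAlgebra
    let ε : B →ₐ[K[X]] K := { e with commutes' := fun p ↦ congr($he p) }
    let ε' : B' →ₐ[K[X]] K := { e' with commutes' := fun p ↦ congr($he' p) }
    exact ⟨(Algebra.TensorProduct.lift ε ε' fun _ _ ↦ Commute.all _ _).toRingHom,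
      (Algebra.TensorProduct.lift ε ε' fun _ _ ↦ Commute.all _ _).comp_algebraMap⟩
  · intro s ε hε
    refine ⟨h s (ε.comp Algebra.TensorProduct.includeLeftRingHom) ?_,
      h' s (ε.comp (Algebra.TensorProduct.includeRight (R := K[X])).toRingHom) ?_⟩
    · rw [← hε]; rfl
    · rw [← hε, RingHom.comp_assoc]
      congr 1
      exact (Algebra.TensorProduct.includeRight (R := K[X]) (A := B) (B := B')).comp_algebraMap

variable {R : Type u} [CommRing R] [Algebra K[X] R]

variable (K R) in
/-- The values of the coordinate at the rational points of a scheme over the affine line. -/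
def coordinateValues : Set K :=
  {s | ∃ e : R →+* K, e.comp (algebraMap K[X] R) = evalRingHom s}

theorem containsEtaleNeighborhood_coordinateValues [Algebra.Etale K[X] R] {a c : K}
    (ha : a ∈ coordinateValues K R) (hc : c ≠ 0) :
    ContainsEtaleNeighborhood {t | a + c * t ∈ coordinateValues K R} := by
  -- The change of coordinate `t = (X - a) / c` moves the point above `a` to one above `0`.
  let τ : K[X] →+* K[X] := eval₂RingHom C (C c⁻¹ * (X - C a))
  have hτ : Function.Bijective τ := by
    refine Function.bijective_iff_has_inverse.2 ⟨eval₂RingHom C (C c * X + C a), ?_, ?_⟩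
    · refine RingHom.congr_fun (g := RingHom.id _)
        (f := (eval₂RingHom C (C c * X + C a)).comp τ) (Polynomial.ringHom_ext ?_ ?_)
      · simp [τ]
      · simp [τ, ← mul_assoc, ← C_mul, inv_mul_cancel₀ hc]
    · refine RingHom.congr_fun (g := RingHom.id _)
        (f := τ.comp (eval₂RingHom C (C c * X + C a))) (Polynomial.ringHom_ext ?_ ?_)
      · simp [τ]
      · simp [τ, ← mul_assoc, ← C_mul, mul_inv_cancel₀ hc]
  let ρ : K[X] →+* R := algebraMap K[X] R
  have hρ : ρ.Etale := RingHom.etale_algebraMap.2 ‹_›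
  let alg : Algebra K[X] R := (ρ.comp τ).toAlgebra
  have halg : @algebraMap K[X] R _ _ alg = ρ.comp τ := rfl
  have hτe : RingHom.Etale τ := .of_bijective hτ
  refine ⟨R, inferInstance, alg, ?_, ?_, ?_⟩
  · exact RingHom.Etale.stableUnderComposition τ ρ hτe hρ
  · obtain ⟨e, he⟩ := ha
    refine ⟨e, ?_⟩
    rw [halg, ← RingHom.comp_assoc, he]
    refine Polynomial.ringHom_ext ?_ ?_ <;> simp [τ]
  · rintro t e he
    rw [halg] at he
    refine ⟨e, Polynomial.ringHom_ext (fun x ↦ ?_) ?_⟩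
    · simpa [τ] using congr($he (C x))
    · have h1 := congr($he X)
      have h2 (x : K) : e (ρ (C x)) = x := by simpa [τ] using congr($he (C x))
      have h3 : τ X = C c⁻¹ * (X - C a) := by simp [τ]
      simp only [RingHom.comp_apply, h3, map_mul, map_sub, h2, coe_evalRingHom, eval_X] at h1
      change e (ρ X) = _
      simp only [coe_evalRingHom, eval_X]
      rw [← h1]
      field_simp
      ring

/-- One `t` yields two pairs with ratio `b`, at the displacements `t` and `c * t`, so that one pair
remains if the other meets a subfield. -/
theorem exists_add_mul_mem_coordinateValues (hK : IsAmple K) [Algebra.Etale K[X] R] {a b c : K}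
    (ha : a ∈ coordinateValues K R) (hb : b ≠ 0) (hc : c ≠ 0) :
    ∃ t : K, t ≠ 0 ∧ a + t ∈ coordinateValues K R ∧ a + b * t ∈ coordinateValues K R ∧
      a + c * t ∈ coordinateValues K R ∧ a + b * (c * t) ∈ coordinateValues K R := by
  have h {c : K} (hc : c ≠ 0) := containsEtaleNeighborhood_coordinateValues ha hc
  obtain ⟨t, ⟨⟨⟨h1, h2⟩, h3⟩, h4⟩, ht⟩ :=
    ((((h one_ne_zero).inter (h hb)).inter (h hc)).inter (h (mul_ne_zero hb hc))).exists_ne_zero hK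
  exact ⟨t, ht, by simpa using h1, h2, h3, by simpa [mul_assoc] using h4⟩

-- A ratio is determined by the pair `(x, y)`, so `T` injects into `Y × Y`, which is equinumerous
-- with the necessarily infinite `Y`.
open Cardinal in
theorem mk_le_mk_of_forall_exists_ratio {T Y : Set K} (hT : ℵ₀ ≤ #T) (a : K)
    (h : ∀ b ∈ T, ∃ x ∈ Y, ∃ y ∈ Y, b = (y - a) / (x - a)) : #T ≤ #Y := by
  choose! x hx y hy hxy using h
  have h1 : #T ≤ #(Y × Y) := by
    refine mk_le_of_injective (f := fun b : T ↦ (⟨x b, hx b b.2⟩, ⟨y b, hy b b.2⟩)) ?_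
    intro b b' hbb
    simp only [Prod.mk.injEq, Subtype.mk.injEq] at hbb
    rw [Subtype.ext_iff, hxy b b.2, hxy b' b'.2, hbb.1, hbb.2]
  rw [mk_prod] at h1
  simp only [lift_id] at h1
  have h2 : ℵ₀ ≤ #Y := by
    by_contra hlt
    exact absurd (hT.trans h1) (not_le.2 (mul_lt_aleph0 (not_le.1 hlt) (not_le.1 hlt)))
  rwa [mul_eq_self h2] at h1

open Cardinal in
theorem mk_setOf_ne_zero {T : Set K} (hT : ℵ₀ ≤ #T) : #↥(T \ {0}) = #T := by
  refine le_antisymm (mk_le_mk_of_subset Set.sdiff_subset) ?_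
  by_contra hlt
  have h : #T ≤ #↥(T \ {0}) + #({0} : Set K) :=
    (mk_le_mk_of_subset (by rw [Set.sdiff_union_self]; exact Set.subset_union_left)).trans
      (mk_union_le _ _)
  exact absurd h (not_le.2 (add_lt_of_lt hT (not_le.1 hlt)
    ((mk_singleton _).trans_lt (one_lt_aleph0.trans_le hT))))

open Cardinal in
/-- The values of an étale coordinate at rational points which avoid a proper subfield of an ample
field are as many as the elements of the field. -/
theorem mk_le_mk_coordinateValues_diff (hK : IsAmple K) [Infinite K] [Algebra.Etale K[X] R]
    (hR : (coordinateValues K R).Nonempty) (K₀ : Subfield K) (hK₀ : K₀ ≠ ⊤) :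
    #K ≤ #↥(coordinateValues K R \ (K₀ : Set K)) := by
  set V := coordinateValues K R
  have hKV : #K ≤ #V := by
    obtain ⟨a, ha⟩ := hR
    rw [← mk_univ, ← mk_setOf_ne_zero (T := (Set.univ : Set K)) (by simp)]
    refine mk_le_mk_of_forall_exists_ratio (by rw [mk_setOf_ne_zero] <;> simp) a fun b hb ↦ ?_
    obtain ⟨t, ht, h1, h2, -⟩ := exists_add_mul_mem_coordinateValues hK ha hb.2 one_ne_zero
    exact ⟨_, h1, _, h2, by
      rw [add_sub_cancel_left, add_sub_cancel_left]; field_simp⟩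
  by_cases hV : Disjoint V (K₀ : Set K)
  · rwa [hV.sdiff_eq_left]
  obtain ⟨a, ha, haK⟩ := Set.not_disjoint_iff.1 hV
  -- A smaller `K₀` cannot absorb `V`, which has at least `#K` elements. If `#K₀ = #K`, it suffices
  -- to realize every nonzero `b ∈ K₀` as a ratio of displacements avoiding `K₀`.
  rcases (mk_set_le (K₀ : Set K)).lt_or_eq with hlt | heq
  · by_contra hcon
    have h1 : #V ≤ #↥(V \ (K₀ : Set K)) + #(K₀ : Set K) :=
      (mk_le_mk_of_subset (by rw [Set.sdiff_union_self]; exact Set.subset_union_left)).trans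
        (mk_union_le _ _)
    exact absurd (hKV.trans h1)
      (not_le.2 (add_lt_of_lt (aleph0_le_mk K) (not_le.1 hcon) hlt))
  · obtain ⟨c, hc⟩ : ∃ c, c ∉ K₀ := by
      by_contra! h; exact hK₀ (eq_top_iff.2 fun x _ ↦ h x)
    have hc0 : c ≠ 0 := by rintro rfl; exact hc K₀.zero_mem
    rw [← heq]
    have hinf : ℵ₀ ≤ #(K₀ : Set K) := by rw [heq]; exact aleph0_le_mk K
    rw [← mk_setOf_ne_zero hinf]
    refine mk_le_mk_of_forall_exists_ratio (by rwa [mk_setOf_ne_zero hinf]) a fun b hb ↦ ?_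
    have hb0 : b ≠ 0 := hb.2
    obtain ⟨t, ht, h1, h2, h3, h4⟩ := exists_add_mul_mem_coordinateValues hK ha hb0 hc0
    have key {s : K} (hs : s ∉ K₀) : a + s ∉ K₀ := fun h ↦ hs (by
      simpa using K₀.sub_mem h haK)
    have keyb {s : K} (hs : s ∉ K₀) : b * s ∉ K₀ := fun h ↦ hs (by
      simpa [hb0] using K₀.mul_mem (K₀.inv_mem hb.1) h)
    -- As `c ∉ K₀`, the elements `t` and `c * t` are not both in `K₀`; multiplication by `b ∈ K₀`
    -- and translation by `a ∈ K₀` preserve the complement.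
    by_cases htK : t ∈ K₀
    · have hct : c * t ∉ K₀ := fun h ↦ hc (by
        simpa [ht] using K₀.mul_mem h (K₀.inv_mem htK))
      exact ⟨_, ⟨h3, key hct⟩, _, ⟨h4, key (keyb hct)⟩, by
      rw [add_sub_cancel_left, add_sub_cancel_left]; field_simp⟩
    · exact ⟨_, ⟨h1, key htK⟩, _, ⟨h2, key (keyb htK)⟩, by
      rw [add_sub_cancel_left, add_sub_cancel_left]; field_simp⟩

end Large

/-! ### Étale coordinates on smooth affine curves. -/

section SeparatingCoordinate

theorem krullDimLE_one_of_isLocalization {S : Type*} [CommRing S] [IsDomain S]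
    [Ring.KrullDimLE 1 S] (M : Submonoid S) (A : Type*) [CommRing A] [Algebra S A]
    [IsLocalization M A] : Ring.KrullDimLE 1 A := by
  refine Ring.KrullDimLE.mk₁' fun I hI hI' ↦ ?_
  obtain ⟨m, hm, hle⟩ := Ideal.exists_le_maximal I hI'.ne_top
  have h0 : I.under S ≠ ⊥ := fun h ↦ hI (by
    rw [← IsLocalization.map_under M A I, h, Ideal.map_bot])
  have h1 : (I.under S).IsMaximal := (inferInstance : (I.under S).IsPrime).isMaximal_of_ne_bot h0
  have h2 : I.under S = m.under S :=
    h1.eq_of_le (inferInstance : (m.under S).IsPrime).ne_top (Ideal.comap_mono hle)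
  rw [← IsLocalization.map_under M A I, h2, IsLocalization.map_under M A m]
  exact hm

variable {K : Type u} [Field K]

open MvPolynomial in
/-- A formally smooth algebra is formally étale over affine space if the differentials of the
coordinates are a basis of the module of differentials. -/
theorem formallyEtale_mvPolynomial_of_basis {κ : Type*} {F : Type u} [CommRing F] [Algebra K F]
    [Algebra.FormallySmooth K F] [Algebra (MvPolynomial κ K) F]
    [IsScalarTower K (MvPolynomial κ K) F] (b : Module.Basis κ F (Ω[F⁄K]))
    (hb : ∀ k, b k = KaehlerDifferential.D K F (algebraMap (MvPolynomial κ K) F (X k))) :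
    Algebra.FormallyEtale (MvPolynomial κ K) F := by
  let β := (KaehlerDifferential.mvPolynomialBasis K κ).baseChange F
  have hβ : (KaehlerDifferential.mapBaseChange K (MvPolynomial κ K) F) = (β.equiv b (.refl κ)).toLinearMap := by
    refine β.ext fun k ↦ ?_
    refine Eq.trans ?_ (β.equiv_apply k b (.refl κ)).symm
    simp [β, KaehlerDifferential.mvPolynomialBasis_apply, hb]
  have hbij : Function.Bijective (KaehlerDifferential.mapBaseChange K (MvPolynomial κ K) F) := by
    rw [hβ]; exact (β.equiv b (.refl κ)).bijective
  -- In the Jacobi–Zariski sequence of `K → K[X_κ] → F`, surjectivity of the base change map kills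
  -- the relative differentials; injectivity, with the vanishing of `H₁` of `F` over `K`, kills the
  -- relative `H₁`.
  refine (Algebra.formallyEtale_iff _ _).2 ⟨?_, ?_⟩
  · refine subsingleton_of_forall_eq 0 fun x ↦ ?_
    obtain ⟨y, rfl⟩ := KaehlerDifferential.map_surjective K (MvPolynomial κ K) F x
    exact (KaehlerDifferential.exact_mapBaseChange_map K (MvPolynomial κ K) F y).2 (hbij.2 y)
  · refine subsingleton_of_forall_eq 0 fun x ↦ ?_
    have h1 : Algebra.H1Cotangent.δ K (MvPolynomial κ K) F x = 0 :=
      hbij.1 (((Algebra.H1Cotangent.exact_δ_mapBaseChange K (MvPolynomial κ K) F _).2 ⟨x, rfl⟩).trans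
        (map_zero _).symm)
    obtain ⟨y, rfl⟩ := (Algebra.H1Cotangent.exact_map_δ K (MvPolynomial κ K) F x).1 h1
    rw [Subsingleton.elim y 0, map_zero]

open MvPolynomial in
/-- The dimension of affine space bounds the number of étale coordinates. -/
theorem subsingleton_of_etale_of_krullDimLE_one {κ : Type*} {A : Type u} [CommRing A] [IsDomain A]
    [Ring.KrullDimLE 1 A] [Algebra K A] [Algebra (MvPolynomial κ K) A]
    [IsScalarTower K (MvPolynomial κ K) A] [Algebra.Etale (MvPolynomial κ K) A]
    (e : A →ₐ[K] K) : Subsingleton κ := by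
  classical
  refine ⟨fun k₁ k₂ ↦ by_contra fun hne ↦ ?_⟩
  let P := MvPolynomial κ K
  let c : κ → K := fun k ↦ e (algebraMap P A (X k))
  let m : Ideal A := RingHom.ker e
  have : m.IsPrime := RingHom.ker_isPrime _
  -- The kernel `p` is the ideal of the line through the image point parallel to the `k₁`-axis. A
  -- second index makes `p` nonzero, and going down lifts `p < m.under P` to a nonzero nonmaximal
  -- prime of `A`.
  let θ : P →ₐ[K] K[X] := aeval fun k ↦ if k = k₁ then Polynomial.X else Polynomial.C (c k)
  have hθ (k : κ) : θ (X k) = if k = k₁ then Polynomial.X else Polynomial.C (c k) :=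
    MvPolynomial.aeval_X _ _
  let p : Ideal P := RingHom.ker θ
  have : p.IsPrime := RingHom.ker_isPrime _
  have hcomp : (Polynomial.aeval (c k₁)).comp θ = e.comp (IsScalarTower.toAlgHom K P A) := by
    refine MvPolynomial.algHom_ext fun k ↦ ?_
    rw [AlgHom.comp_apply, hθ]
    by_cases hk : k = k₁
    · subst hk; simp [c, P]
    · simp [c, P, hk]
  have hle : p ≤ m.under P := fun x hx ↦ by
    have hx' : θ x = 0 := hx
    have := congr($hcomp x)
    simp only [AlgHom.comp_apply, hx', map_zero] at this
    exact this.symm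
  have hlt : p < m.under P := by
    refine lt_of_le_of_ne hle fun h ↦ ?_
    have hmem : (X k₁ - algebraMap K P (c k₁) : P) ∈ m.under P := by
      change e (algebraMap P A (X k₁ - algebraMap K P (c k₁))) = 0
      rw [map_sub, map_sub, ← IsScalarTower.algebraMap_apply K P A, AlgHom.commutes]
      exact sub_self _
    rw [← h] at hmem
    have h0 : θ (X k₁ - algebraMap K P (c k₁)) = 0 := hmem
    rw [map_sub, AlgHom.commutes, hθ, if_pos rfl] at h0
    exact Polynomial.X_sub_C_ne_zero _ h0
  obtain ⟨q, hqm, hq, hqp⟩ := Ideal.exists_ideal_lt_liesOver_of_lt m hlt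
  have hq0 : q ≠ ⊥ := by
    rintro rfl
    have hmem : (X k₂ - algebraMap K P (c k₂) : P) ∈ p := by
      change θ _ = 0
      rw [map_sub, AlgHom.commutes, hθ, if_neg (Ne.symm hne)]
      exact sub_self _
    rw [hqp.over] at hmem
    have h0 : algebraMap P A (X k₂ - algebraMap K P (c k₂)) = 0 := hmem
    rw [map_eq_zero_iff _ (FaithfulSMul.algebraMap_injective P A), sub_eq_zero] at h0
    have h1 := congrArg (MvPolynomial.totalDegree) h0
    rw [MvPolynomial.totalDegree_X, MvPolynomial.algebraMap_eq, MvPolynomial.totalDegree_C] at h1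
    exact one_ne_zero h1
  exact hqm.ne ((hq.isMaximal_of_ne_bot hq0).eq_of_le (RingHom.ker_ne_top _) hqm.le)

/-- Without coordinates the base is a field, so incomparability of primes gives `ker e = ⊥`; every
element is then constant and `e` is the only point. -/
theorem nonempty_of_etale_of_ne {κ : Type*} {A : Type u} [CommRing A] [IsDomain A]
    [Algebra K A] [Algebra (MvPolynomial κ K) A] [IsScalarTower K (MvPolynomial κ K) A]
    [Algebra.Etale (MvPolynomial κ K) A] {e e' : A →ₐ[K] K} (h : e ≠ e') : Nonempty κ := by
  by_contra hκ
  rw [not_nonempty_iff] at hκ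
  apply h
  let P := MvPolynomial κ K
  have hP : IsField P := (MvPolynomial.isEmptyRingEquiv K κ).toMulEquiv.isField (Field.toIsField K)
  let := hP.toField
  have hP' (I : Ideal P) (hI : I ≠ ⊤) : I = ⊥ := (Ideal.eq_bot_or_top I).resolve_right hI
  let m : Ideal A := RingHom.ker e
  have : m.IsPrime := RingHom.ker_isPrime _
  have hm : ⊥ = m := Algebra.QuasiFinite.eq_of_le_of_under_eq (R := P) ⊥ m bot_le (by
    rw [hP' _ (inferInstance : ((⊥ : Ideal A).under P).IsPrime).ne_top,
      hP' _ (inferInstance : (m.under P).IsPrime).ne_top])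
  ext a
  have h1 : a - algebraMap K A (e a) ∈ m := by simp [m, RingHom.mem_ker]
  rw [← hm, Ideal.mem_bot, sub_eq_zero] at h1
  conv_rhs => rw [h1, AlgHom.commutes]
  rfl

/-- Among finitely many functions on an affine smooth curve whose differentials generate the
differentials of the function field there is an étale coordinate on a nonempty open subset. -/
theorem exists_etale_localizationAway {S : Type u} [CommRing S] [IsDomain S] [Algebra K S]
    [Algebra.Smooth K S] [Ring.KrullDimLE 1 S]
    (hS : ∀ f : S, f ≠ 0 → ∃ e e' : S →ₐ[K] K, e ≠ e' ∧ e f ≠ 0 ∧ e' f ≠ 0)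
    (F : Type u) [Field F] [Algebra S F] [Algebra K F] [IsScalarTower K S F] [IsFractionRing S F]
    {ι : Type} [Finite ι] (h : ι → S)
    (hspan : Submodule.span F (Set.range fun j ↦ KaehlerDifferential.D K F (algebraMap S F (h j)))
      = ⊤) :
    ∃ (j : ι) (f : S), f ≠ 0 ∧
      ((algebraMap S (Localization.Away f)).comp
        (eval₂RingHom (algebraMap K S) (h j))).Etale := by
  obtain ⟨κ, a, ha, hspan', hli⟩ := exists_linearIndependent' F
    (fun j ↦ KaehlerDifferential.D K F (algebraMap S F (h j)))
  have : Finite κ := Finite.of_injective a ha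
  let b : Module.Basis κ F (Ω[F⁄K]) := Module.Basis.mk hli (by rw [hspan', hspan])
  let P := MvPolynomial κ K
  let φ : P →ₐ[K] S := MvPolynomial.aeval (h ∘ a)
  let : Algebra P S := φ.toAlgebra
  have : IsScalarTower K P S := .of_algebraMap_eq fun x ↦ (φ.commutes x).symm
  let : Algebra P F := ((algebraMap S F).comp (algebraMap P S)).toAlgebra
  have : IsScalarTower P S F := .of_algebraMap_eq fun _ ↦ rfl
  have : IsScalarTower K P F := .of_algebraMap_eq fun x ↦ by
    rw [IsScalarTower.algebraMap_apply P S F, ← IsScalarTower.algebraMap_apply K P S,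
      ← IsScalarTower.algebraMap_apply K S F]
  have : Algebra.FormallyEtale S F := Algebra.FormallyEtale.of_isLocalization (nonZeroDivisors S)
  have : Algebra.FormallySmooth K F := Algebra.FormallySmooth.comp K S F
  have hX (k : κ) : algebraMap P S (MvPolynomial.X k) = h (a k) := by
    exact MvPolynomial.aeval_X _ _
  have hF : Algebra.FormallyEtale P F := formallyEtale_mvPolynomial_of_basis b fun k ↦ by
    rw [IsScalarTower.algebraMap_apply P S F, hX]; simp [b]
  have : Algebra.FinitePresentation P S :=
    Algebra.FinitePresentation.of_restrict_scalars_finitePresentation K P S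
  have : IsLocalization (nonZeroDivisors S) (Localization.AtPrime (⊥ : Ideal S)) := by
    have : (⊥ : Ideal S).primeCompl = nonZeroDivisors S := by
      ext x; simp [Ideal.primeCompl]
    rw [← this]; infer_instance
  -- The local ring at the generic point is `F`; étaleness there spreads out to a basic open set.
  have : Algebra.IsEtaleAt P (⊥ : Ideal S) := Algebra.FormallyEtale.of_equiv
    ((IsLocalization.algEquiv (nonZeroDivisors S) F
      (Localization.AtPrime (⊥ : Ideal S))).restrictScalars P)
  obtain ⟨f, hf, hfe⟩ := Algebra.exists_etale_of_isEtaleAt (R := P) (⊥ : Ideal S)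
  have hf0 : f ≠ 0 := by simpa using hf
  let A := Localization.Away f
  have hM : Submonoid.powers f ≤ nonZeroDivisors S := powers_le_nonZeroDivisors_of_noZeroDivisors hf0
  have : IsDomain A := IsLocalization.isDomain_localization hM
  have : Ring.KrullDimLE 1 A := krullDimLE_one_of_isLocalization (Submonoid.powers f) A
  have : IsScalarTower K P A := .of_algebraMap_eq fun x ↦ by
    rw [IsScalarTower.algebraMap_apply P S A, ← IsScalarTower.algebraMap_apply K P S,
      ← IsScalarTower.algebraMap_apply K S A]
  obtain ⟨e, e', hne, hef, hef'⟩ := hS f hf0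
  let lift (e : S →ₐ[K] K) (he : e f ≠ 0) : A →ₐ[K] K :=
    IsLocalization.liftAlgHom (M := Submonoid.powers f) (f := e) (by
      rintro ⟨_, n, rfl⟩; rw [map_pow]; exact (IsUnit.mk0 _ he).pow n)
  have hlift (e : S →ₐ[K] K) (he : e f ≠ 0) (x : S) : lift e he (algebraMap S A x) = e x := by
    simp [lift]
  -- One rational point bounds the number of coordinates by one, and a second, distinct point
  -- excludes zero.
  have : Subsingleton κ := subsingleton_of_etale_of_krullDimLE_one (lift e hef)
  have : Nonempty κ := nonempty_of_etale_of_ne (e := lift e hef) (e' := lift e' hef') fun heq ↦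
    hne (AlgHom.ext fun x ↦ by rw [← hlift e hef, heq, hlift e' hef'])
  obtain ⟨k⟩ := this
  let : Unique κ := ⟨⟨k⟩, fun _ ↦ Subsingleton.elim _ _⟩
  refine ⟨a k, f, hf0, ?_⟩
  let E := (MvPolynomial.uniqueAlgEquiv K κ).symm
  have h1 := RingHom.Etale.stableUnderComposition E.toRingEquiv.toRingHom (algebraMap P A)
    (RingHom.Etale.of_bijective E.bijective) (RingHom.etale_algebraMap.2 hfe)
  convert h1
  refine Polynomial.ringHom_ext (fun x ↦ ?_) ?_
  · change algebraMap S A (eval₂ _ _ (C x)) = algebraMap P A (E (algebraMap K K[X] x))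
    rw [AlgEquiv.commutes, ← IsScalarTower.algebraMap_apply K P A, eval₂_C,
      ← IsScalarTower.algebraMap_apply K S A]
  · change algebraMap S A (eval₂ _ _ X) = algebraMap P A (E X)
    have hE : E X = MvPolynomial.X k := by
      rw [AlgEquiv.symm_apply_eq]; simp
    rw [hE, eval₂_X, IsScalarTower.algebraMap_apply P S A, hX]

end SeparatingCoordinate

/-! ### Differentials of separable extensions. -/

section SeparableExtension

/-- In a separable extension of a field generated by `x`, the differentials of `x` generate all
differentials. -/
theorem span_D_eq_top_of_isSeparable {K E F : Type u} [Field K] [Field E] [Field F] [Algebra K E]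
    [Algebra E F] [Algebra K F] [IsScalarTower K E F] [Algebra.IsSeparable E F] {ι : Type*}
    (x : ι → E) (hx : ∀ z : E, ∃ p q : MvPolynomial ι K,
      MvPolynomial.aeval x q ≠ 0 ∧ z * MvPolynomial.aeval x q = MvPolynomial.aeval x p) :
    Submodule.span F (Set.range fun j ↦ KaehlerDifferential.D K F (algebraMap E F (x j))) = ⊤ := by
  set N := Submodule.span F (Set.range fun j ↦ KaehlerDifferential.D K F (algebraMap E F (x j)))
  have hpoly (p : MvPolynomial ι K) :
      KaehlerDifferential.D K F (algebraMap E F (MvPolynomial.aeval x p)) ∈ N := by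
    induction p using MvPolynomial.induction_on with
    | C a =>
      rw [← MvPolynomial.algebraMap_eq, AlgHom.commutes, ← IsScalarTower.algebraMap_apply K E F,
        Derivation.map_algebraMap]
      exact N.zero_mem
    | add p q hp hq => simpa only [map_add] using N.add_mem hp hq
    | mul_X p j hp =>
      rw [map_mul, map_mul, Derivation.leibniz, MvPolynomial.aeval_X]
      exact N.add_mem (N.smul_mem _ (Submodule.subset_span ⟨j, rfl⟩)) (N.smul_mem _ hp)
  have hE (z : E) : KaehlerDifferential.D K F (algebraMap E F z) ∈ N := by
    obtain ⟨p, q, hq, hz⟩ := hx z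
    have h := congrArg (fun y ↦ KaehlerDifferential.D K F (algebraMap E F y)) hz
    simp only [map_mul, Derivation.leibniz] at h
    have hq' : algebraMap E F (MvPolynomial.aeval x q) ≠ 0 :=
      (map_ne_zero_iff _ (algebraMap E F).injective).2 hq
    -- The quotient rule, with denominators cleared.
    rw [← N.smul_mem_iff hq', ← add_sub_cancel_left
      (algebraMap E F z • KaehlerDifferential.D K F (algebraMap E F (MvPolynomial.aeval x q)))
      (algebraMap E F (MvPolynomial.aeval x q) • KaehlerDifferential.D K F (algebraMap E F z)), h]
    exact N.sub_mem (hpoly p) (N.smul_mem _ (hpoly q))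
  -- Separability gives `Ω[F⁄E] = 0`, so the differentials of `E` span those of `F`.
  have : Algebra.FormallyUnramified E F := Algebra.FormallyUnramified.of_isSeparable E F
  refine Submodule.eq_top_iff'.2 fun ω ↦ ?_
  obtain ⟨y, rfl⟩ := (KaehlerDifferential.exact_mapBaseChange_map K E F ω).1
    (Subsingleton.elim _ _)
  induction y using TensorProduct.induction_on with
  | zero => simp
  | add a b ha hb => rw [map_add]; exact N.add_mem ha hb
  | tmul f ω =>
    rw [KaehlerDifferential.mapBaseChange_tmul]
    refine N.smul_mem _ ?_
    have hω : ω ∈ Submodule.span E (Set.range (KaehlerDifferential.D K E)) := by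
      rw [KaehlerDifferential.span_range_derivation]; trivial
    induction hω using Submodule.span_induction with
    | mem _ h => obtain ⟨z, rfl⟩ := h; simpa using hE z
    | zero => simp
    | add a b _ _ ha hb => rw [map_add]; exact N.add_mem ha hb
    | smul c a _ ha =>
      rw [map_smul, ← algebraMap_smul F c]
      exact N.smul_mem _ ha

end SeparableExtension

/-! ### Values of a coordinate on a smooth affine curve. -/

section RationalValues

variable {K : Type u} [Field K] {S : Type u} [CommRing S] [Algebra K S]

theorem infinite_of_infinite_algHom [Algebra.FiniteType K S] [Infinite (S →ₐ[K] K)] :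
    Infinite K := by
  by_contra hfin
  rw [not_infinite_iff_finite] at hfin
  obtain ⟨s, hs⟩ := (Algebra.FiniteType.out : (⊤ : Subalgebra K S).FG)
  refine not_finite_iff_infinite.2 ‹Infinite (S →ₐ[K] K)› ?_
  refine Finite.of_injective (fun (e : S →ₐ[K] K) (x : s) ↦ e x) fun e e' h ↦ ?_
  refine AlgHom.ext_of_adjoin_eq_top hs fun x hx ↦ ?_
  exact congr_fun h ⟨x, hx⟩

open Cardinal in
/-- Some coordinate of a separable map from an affine smooth curve over an ample field takes as
many values outside of a given proper subfield as there are elements in the field. -/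
theorem exists_mk_le_mk_values_diff [IsDomain S] [Algebra.Smooth K S] [Ring.KrullDimLE 1 S]
    [Infinite (S →ₐ[K] K)] (hK : IsAmple K)
    (F : Type u) [Field F] [Algebra S F] [Algebra K F] [IsScalarTower K S F] [IsFractionRing S F]
    {ι : Type} [Finite ι] (h : ι → S)
    (hspan : Submodule.span F (Set.range fun j ↦ KaehlerDifferential.D K F (algebraMap S F (h j)))
      = ⊤) (K₀ : Subfield K) (hK₀ : K₀ ≠ ⊤) :
    ∃ j, #K ≤ #↥(Set.range (fun e : S →ₐ[K] K ↦ e (h j)) \ (K₀ : Set K)) := by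
  have hinf (f : S) (hf : f ≠ 0) : {e : S →ₐ[K] K | e f = 0}ᶜ.Infinite :=
    (finite_algHom_apply_eq_zero hf).infinite_compl
  obtain ⟨j, f, hf, hét⟩ := exists_etale_localizationAway (fun f hf ↦ by
    obtain ⟨e, he, e', he', hne⟩ := (hinf f hf).nontrivial
    exact ⟨e, e', hne, he, he'⟩) F h hspan
  have : Infinite K := infinite_of_infinite_algHom (S := S)
  let A := Localization.Away f
  let : Algebra K[X] A := ((algebraMap S A).comp (eval₂RingHom (algebraMap K S) (h j))).toAlgebra
  have halg : algebraMap K[X] A =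
    (algebraMap S A).comp (eval₂RingHom (algebraMap K S) (h j)) := rfl
  have : Algebra.Etale K[X] A := hét
  refine ⟨j, (mk_le_mk_coordinateValues_diff (R := A) hK ?_ K₀ hK₀).trans
    (mk_le_mk_of_subset (Set.sdiff_subset_sdiff_left ?_))⟩
  · obtain ⟨e, he⟩ := (hinf f hf).nonempty
    refine ⟨e (h j), IsLocalization.Away.lift f (g := e.toRingHom) (IsUnit.mk0 _ he), ?_⟩
    rw [halg, ← RingHom.comp_assoc]
    refine Polynomial.ringHom_ext (fun x ↦ ?_) ?_ <;> simp
  · rintro s ⟨e, he⟩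
    rw [halg, ← RingHom.comp_assoc] at he
    refine ⟨{ e.comp (algebraMap S A) with
      commutes' := fun x ↦ by simpa using congr($he (C x)) }, ?_⟩
    simpa using congr($he X)

end RationalValues

end CommutativeAlgebra

/-! ### Affine charts of a curve with a simple rational point. -/

section Charts

variable (K : Type u) [Field K]

/-- A rational point of a separated scheme is closed. -/
theorem RationalPoint.isClosed_singleton {K : Type u} [Field K] {X : Scheme.{u}}
    [X.Over (Spec (.of K))] [IsSeparated (X ↘ Spec (.of K))] (P : RationalPoint K X) :
    IsClosed {P.1 (IsLocalRing.closedPoint K)} := by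
  have h1 : IsClosedImmersion (P.1 ≫ (X ↘ Spec (.of K))) := by
    rw [P.2]; infer_instance
  have h2 : IsClosedImmersion P.1 := .of_comp P.1 (X ↘ Spec (.of K))
  have h3 := P.1.isClosedEmbedding.isClosed_range
  have : Set.range P.1 = {P.1 (IsLocalRing.closedPoint K)} := by
    ext x
    simp only [Set.mem_range, Set.mem_singleton_iff]
    exact ⟨fun ⟨y, hy⟩ ↦ by
      rw [← hy, Subsingleton.elim y (IsLocalRing.closedPoint K)], fun h ↦ ⟨_, h.symm⟩⟩
  rwa [this] at h3

/-- After base change `X` is open in an integral scheme; surjectivity keeps it nonempty. -/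
theorem geometricallyIntegral_comp {X Y S : Scheme.{u}} (f : X ⟶ Y) (g : Y ⟶ S)
    [IsOpenImmersion f] [Surjective (f ≫ g)] [GeometricallyIntegral g] :
    GeometricallyIntegral (f ≫ g) := by
  refine ⟨fun L _ y Z fst snd h ↦ ?_⟩
  let p : Z ⟶ Limits.pullback g y := Limits.pullback.lift (fst ≫ f) snd (by simpa using h.w)
  have hs : p ≫ Limits.pullback.snd g y = snd := Limits.pullback.lift_snd _ _ _
  have hp : IsPullback fst p f (Limits.pullback.fst g y) :=
    (IsPullback.of_right (by rw [hs]; exact h.flip)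
      (Limits.pullback.lift_fst _ _ _) (IsPullback.of_hasPullback g y).flip).flip
  have : IsOpenImmersion p := MorphismProperty.of_isPullback hp ‹_›
  have : IsIntegral (Limits.pullback g y) :=
    GeometricallyIntegral.geometrically_isIntegral _ _ _ (.of_hasPullback _ _)
  have : Surjective snd := MorphismProperty.of_isPullback h ‹_›
  have : Nonempty Z := ⟨(snd.surjective (Classical.arbitrary _)).choose⟩
  exact isIntegral_of_isOpenImmersion p

theorem krullDimLE_one_of_isAffineOpen (K : Type u) [Field K] {C : Scheme.{u}}
    [C.Over (Spec (.of K))] [IsCurve K C] {V : C.Opens} (hV : IsAffineOpen V) :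
    Ring.KrullDimLE 1 Γ(C, V) := by
  rw [Ring.krullDimLE_iff, ← PrimeSpectrum.topologicalKrullDim_eq_ringKrullDim Γ(C, V)]
  have h := Topology.IsInducing.topologicalKrullDim_le
    hV.fromSpec.isOpenEmbedding.isInducing
  rw [IsCurve.dimension_eq_one (K := K) (C := C)] at h
  exact h

variable {K} {C : Scheme.{u}} [C.Over (Spec (.of K))] [IsCurve K C]

/-- The affine neighbourhoods of a rational point of a curve have dimension one. -/
theorem ringKrullDim_eq_one_of_mem {V : C.Opens} (hV : IsAffineOpen V) (P : RationalPoint K C)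
    (hP : P.1 (IsLocalRing.closedPoint K) ∈ V) : ringKrullDim Γ(C, V) = 1 := by
  have := IsCurve.isIntegral K C
  have := IsCurve.isSeparated (K := K) (C := C)
  have := krullDimLE_one_of_isAffineOpen K hV
  refine le_antisymm ((Ring.krullDimLE_iff (n := 1)).1 inferInstance) ?_
  -- In dimension zero the rational point would be generic; being closed, it would be all of `C`,
  -- which has dimension one.
  by_contra hlt
  have h0 : Ring.KrullDimLE 0 Γ(C, V) := by
    rw [Ring.krullDimLE_iff]
    exact ENat.WithBot.lt_add_one_iff.mp (not_le.mp hlt)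
  have hη : genericPoint C ∈ V := (genericPoint_specializes _).mem_open V.2 hP
  have hsub : Subsingleton (Spec Γ(C, V)) := by
    have : Nonempty V := ⟨⟨_, hP⟩⟩
    have hb : (⊥ : Ideal Γ(C, V)).IsMaximal := Ideal.isMaximal_of_isPrime _
    refine ⟨fun x y ↦ PrimeSpectrum.ext ?_⟩
    rw [← hb.eq_of_le x.2.ne_top bot_le, ← hb.eq_of_le y.2.ne_top bot_le]
  obtain ⟨x, hx⟩ := hV.range_fromSpec.ge hη
  obtain ⟨y, hy⟩ := hV.range_fromSpec.ge hP
  have hgen : genericPoint C = P.1 (IsLocalRing.closedPoint K) := by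
    rw [← hx, ← hy, Subsingleton.elim x y]
  have hcl := P.isClosed_singleton
  have huniv : (Set.univ : Set C) ⊆ {P.1 (IsLocalRing.closedPoint K)} := by
    rw [← hcl.closure_eq, ← hgen, genericPoint_closure]
  have : Subsingleton C := ⟨fun a b ↦ (huniv trivial).trans (huniv trivial : b = _).symm⟩
  have h1 := IsCurve.dimension_eq_one (K := K) (C := C)
  have h2 := topologicalKrullDim_zero_of_discreteTopology C
  rw [h1] at h2
  exact absurd h2 (by decide)

end Charts

section Localization

variable {K A : Type u} [Field K] [CommRing A] [Algebra K A]

theorem infinite_algHom_localizationAway [IsDomain A] [Ring.KrullDimLE 1 A]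
    [Algebra.FiniteType K A] [Infinite (A →ₐ[K] K)] {f : A} (hf : f ≠ 0) (B : Type*) [CommRing B]
    [Algebra A B] [Algebra K B] [IsScalarTower K A B] [IsLocalization.Away f B] :
    Infinite (B →ₐ[K] K) := by
  have hinf : {e : A →ₐ[K] K | e f = 0}ᶜ.Infinite := (finite_algHom_apply_eq_zero hf).infinite_compl
  have := hinf.to_subtype
  have hu (e : ↥{e : A →ₐ[K] K | e f = 0}ᶜ) (y : Submonoid.powers f) : IsUnit (e.1 y.1) := by
    obtain ⟨_, n, rfl⟩ := y
    simpa using (IsUnit.mk0 _ e.2).pow n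
  refine Infinite.of_injective
    (fun e : ↥{e : A →ₐ[K] K | e f = 0}ᶜ ↦ IsLocalization.liftAlgHom (S := B) (hu e)) ?_
  intro e e' h
  refine Subtype.ext (AlgHom.ext fun a ↦ ?_)
  have := DFunLike.congr_fun h (algebraMap A B a)
  simpa using this

end Localization

section Charts

variable {K : Type u} [Field K] {C : Scheme.{u}} [C.Over (Spec (.of K))]

/-- The `K`-algebra structure on the sections of a `K`-scheme over an affine open subset. -/
abbrev sectionAlgebra (K : Type u) [Field K] {C : Scheme.{u}} [C.Over (Spec (.of K))]
    {V : C.Opens} (hV : IsAffineOpen V) : Algebra K Γ(C, V) :=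
  (Spec.preimage (hV.fromSpec ≫ (C ↘ Spec (.of K)))).hom.toAlgebra

theorem specMap_sectionAlgebra {V : C.Opens} (hV : IsAffineOpen V) :
    letI := sectionAlgebra K hV
    Spec.map (CommRingCat.ofHom (algebraMap K Γ(C, V))) = hV.fromSpec ≫ (C ↘ Spec (.of K)) :=
  Spec.map_preimage (hV.fromSpec ≫ (C ↘ Spec (.of K)))

theorem isScalarTower_sectionAlgebra_basicOpen {V : C.Opens} (hV : IsAffineOpen V) (f : Γ(C, V)) :
    letI := sectionAlgebra K hV
    letI := sectionAlgebra K (hV.basicOpen f)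
    IsScalarTower K Γ(C, V) Γ(C, C.basicOpen f) := by
  let := sectionAlgebra K hV
  let := sectionAlgebra K (hV.basicOpen f)
  refine IsScalarTower.of_algebraMap_eq' ?_
  have : CommRingCat.ofHom (algebraMap K Γ(C, C.basicOpen f)) =
      CommRingCat.ofHom (algebraMap K Γ(C, V)) ≫
        C.presheaf.map (homOfLE (C.basicOpen_le f)).op := by
    apply Spec.map_injective
    rw [Spec.map_comp, specMap_sectionAlgebra, specMap_sectionAlgebra, ← Category.assoc,
      IsAffineOpen.map_fromSpec]
  exact congrArg CommRingCat.Hom.hom this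

theorem smooth_sectionAlgebra {U V : C.Opens} (hU : Smooth (U.ι ≫ (C ↘ Spec (.of K))))
    (hV : IsAffineOpen V) (hVU : V ≤ U) :
    letI := sectionAlgebra K hV
    Algebra.Smooth K Γ(C, V) := by
  let := sectionAlgebra K hV
  have hr : Set.range hV.fromSpec ⊆ Set.range U.ι := by
    rw [hV.range_fromSpec, Scheme.Opens.range_ι]; exact hVU
  have hs : Smooth (Spec.map (CommRingCat.ofHom (algebraMap K Γ(C, V)))) := by
    rw [specMap_sectionAlgebra, ← IsOpenImmersion.lift_fac U.ι hV.fromSpec hr, Category.assoc]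
    infer_instance
  exact RingHom.smooth_algebraMap.mp (HasRingHomProperty.Spec_iff.mp hs)

/-- A rational point in an affine open subset is an algebra homomorphism. -/
theorem exists_algHom_of_mem {V : C.Opens} (hV : IsAffineOpen V) (P : RationalPoint K C)
    (hP : P.1 (IsLocalRing.closedPoint K) ∈ V) :
    letI := sectionAlgebra K hV
    Nonempty (Γ(C, V) →ₐ[K] K) := by
  let := sectionAlgebra K hV
  have hr : Set.range P.1 ⊆ Set.range hV.fromSpec := by
    rw [hV.range_fromSpec]
    rintro _ ⟨x, rfl⟩
    rw [Subsingleton.elim x (IsLocalRing.closedPoint K)]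
    exact hP
  let q := IsOpenImmersion.lift hV.fromSpec P.1 hr
  have hq : CommRingCat.ofHom (algebraMap K Γ(C, V)) ≫ Spec.preimage q = 𝟙 _ := by
    apply Spec.map_injective
    rw [Spec.map_comp, Spec.map_preimage, specMap_sectionAlgebra, Spec.map_id]
    exact (Category.assoc _ _ _).symm.trans
      ((congrArg (· ≫ (C ↘ Spec (.of K))) (IsOpenImmersion.lift_fac _ _ hr)).trans P.2)
  exact ⟨{ (Spec.preimage q).hom with
    commutes' := fun r ↦ DFunLike.congr_fun (congrArg CommRingCat.Hom.hom hq) r }⟩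

/-- The simple point may lie outside `U₀`. Ampleness is applied near `P`, and shrinking into `U₀`
then discards only finitely many of the rational points obtained. -/
theorem exists_affine_chart (hK : IsAmple K) [IsCurve K C] (P : RationalPoint K C)
    (hP : P.IsSimple) (U₀ : C.Opens) (hU₀ : (U₀ : Set C).Nonempty) :
    ∃ (W : C.Opens) (hW : IsAffineOpen W), Nonempty W ∧ W ≤ U₀ ∧
      letI := sectionAlgebra K hW
      Algebra.Smooth K Γ(C, W) ∧ Ring.KrullDimLE 1 Γ(C, W) ∧ Infinite (Γ(C, W) →ₐ[K] K) := by
  have := IsCurve.isIntegral K C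
  obtain ⟨U, hPU, hU⟩ := hP
  obtain ⟨V, hV, hPV, hVU⟩ := exists_isAffineOpen_mem_and_subset hPU
  let := sectionAlgebra K hV
  have : Nonempty V := ⟨⟨_, hPV⟩⟩
  have hsm := smooth_sectionAlgebra hU hV hVU
  have hdim := ringKrullDim_eq_one_of_mem hV P hPV
  have := krullDimLE_one_of_isAffineOpen K hV
  obtain ⟨e⟩ := exists_algHom_of_mem hV P hPV
  have hgeom : GeometricallyIntegral (Spec.map (CommRingCat.ofHom (algebraMap K Γ(C, V)))) := by
    have := IsCurve.geometricallyIntegral (K := K) (C := C)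
    have : Surjective (hV.fromSpec ≫ (C ↘ Spec (.of K))) :=
      ⟨fun x ↦ ⟨(⊥ : PrimeSpectrum Γ(C, V)), Subsingleton.elim _ _⟩⟩
    rw [specMap_sectionAlgebra]
    exact geometricallyIntegral_comp _ _
  have hinf := infinite_algHom_of_isAmple hK hgeom hdim e
  have hη : genericPoint C ∈ U₀ :=
    (genericPoint_specializes _).mem_open U₀.2 hU₀.choose_spec
  have hηV : genericPoint C ∈ V := (genericPoint_specializes _).mem_open V.2 hPV
  obtain ⟨f, hf, hηf⟩ := hV.exists_basicOpen_le ⟨_, hη⟩ hηV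
  have hf0 : f ≠ 0 := by
    rintro rfl
    simp at hηf
  let := sectionAlgebra K (hV.basicOpen f)
  have := isScalarTower_sectionAlgebra_basicOpen (K := K) hV f
  have := hV.isLocalization_basicOpen f
  have : Algebra.Smooth Γ(C, V) Γ(C, C.basicOpen f) := .of_isLocalization_Away f
  exact ⟨C.basicOpen f, hV.basicOpen f, ⟨⟨_, hηf⟩⟩, hf,
    Algebra.Smooth.comp K Γ(C, V) Γ(C, C.basicOpen f),
    krullDimLE_one_of_isLocalization (Submonoid.powers f) _,
    infinite_algHom_localizationAway hf0 _⟩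

end Charts

/-! ### Separable morphisms in terms of coordinate rings. -/

section ParametrizedValues

open Cardinal

/-- Let `S` and `B` be the coordinate rings of affine curves over an ample field, and let `θ` be
the comorphism of a dominant separable morphism between them. One coordinate function takes as many
values outside of a proper subfield as the field has elements. -/
theorem exists_mk_le_mk_values_comp_diff {K S B E F : Type u} [Field K] [CommRing S] [CommRing B]
    [Field E] [Field F] [Algebra K S] [Algebra K B] [Algebra B E] [Algebra S F] [Algebra E F]
    [IsDomain S] [Algebra.Smooth K S] [Ring.KrullDimLE 1 S] [Infinite (S →ₐ[K] K)]
    [IsFractionRing S F] [IsFractionRing B E] [Algebra.IsSeparable E F] (hK : IsAmple K)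
    (θ : B →ₐ[K] S)
    (hθ : ∀ b, algebraMap E F (algebraMap B E b) = algebraMap S F (θ b)) {ι : Type} [Finite ι]
    (b : ι → B) (hb : Function.Surjective (MvPolynomial.aeval (R := K) b))
    (K₀ : Subfield K) (hK₀ : K₀ ≠ ⊤) :
    ∃ j, #K ≤ #↥(Set.range (fun e : S →ₐ[K] K ↦ e (θ (b j))) \ (K₀ : Set K)) := by
  let : Algebra K E := ((algebraMap B E).comp (algebraMap K B)).toAlgebra
  let : Algebra K F := ((algebraMap S F).comp (algebraMap K S)).toAlgebra
  have : IsScalarTower K B E := .of_algebraMap_eq fun _ ↦ rfl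
  have : IsScalarTower K S F := .of_algebraMap_eq fun _ ↦ rfl
  have : IsScalarTower K E F := .of_algebraMap_eq fun c ↦ by
    change algebraMap S F (algebraMap K S c) = algebraMap E F (algebraMap B E (algebraMap K B c))
    rw [hθ, θ.commutes]
  have hspan := span_D_eq_top_of_isSeparable (K := K) (F := F) (fun j ↦ algebraMap B E (b j))
    (fun z ↦ by
      obtain ⟨a, s, hs, rfl⟩ := IsFractionRing.div_surjective (A := B) z
      obtain ⟨p, rfl⟩ := hb a
      obtain ⟨q, rfl⟩ := hb s
      have h (p : MvPolynomial ι K) : MvPolynomial.aeval (fun j ↦ algebraMap B E (b j)) p =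
          algebraMap B E (MvPolynomial.aeval b p) := by
        exact MvPolynomial.aeval_algebraMap_apply E b p
      have hq : algebraMap B E (MvPolynomial.aeval b q) ≠ 0 :=
        (IsLocalization.map_units E (⟨_, hs⟩ : nonZeroDivisors B)).ne_zero
      exact ⟨p, q, by rwa [h], by rw [h, h, div_mul_cancel₀ _ hq]⟩)
  simp only [hθ] at hspan
  exact exists_mk_le_mk_values_diff hK F (fun j ↦ θ (b j)) hspan K₀ hK₀

end ParametrizedValues

/-! ### Partial maps and their comorphisms. -/

section FunctionField

variable {X Y : Scheme.{u}} (g : X.PartialMap Y) {W : X.Opens} (hW : IsAffineOpen W)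
  (hWg : W ≤ g.domain)

theorem range_fromSpec_subset_range_ι {X Y : Scheme.{u}} (g : X.PartialMap Y) {W : X.Opens}
    (hW : IsAffineOpen W) (hWg : W ≤ g.domain) :
    Set.range hW.fromSpec ⊆ Set.range g.domain.ι := by
  rw [hW.range_fromSpec, Scheme.Opens.range_ι]
  exact hWg

/-- The restriction of a partial map to an affine open subset of its domain. -/
def restrictSpec : Spec Γ(X, W) ⟶ Y :=
  IsOpenImmersion.lift g.domain.ι hW.fromSpec (range_fromSpec_subset_range_ι g hW hWg) ≫ g.hom

variable [IsIntegral X] [Nonempty W]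

theorem fromFunctionField_eq_restrictSpec :
    g.fromFunctionField = Spec.map (X.germToFunctionField W) ≫ restrictSpec g hW hWg := by
  have h := (genericPoint_specializes (Classical.arbitrary W).1).mem_open W.2
    (Classical.arbitrary W).2
  have hη := hWg h
  have : g.domain.fromSpecStalkOfMem _ hη = Spec.map (X.germToFunctionField W) ≫
      IsOpenImmersion.lift g.domain.ι hW.fromSpec (range_fromSpec_subset_range_ι g hW hWg) := by
    rw [← cancel_mono g.domain.ι, Category.assoc, IsOpenImmersion.lift_fac,
      Scheme.Opens.fromSpecStalkOfMem_ι]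
    exact (hW.fromSpecStalk_eq_fromSpecStalk h).symm
  exact (congrArg (· ≫ g.hom) this).trans (Category.assoc _ _ _)

/-- The comorphism of a partial map on an affine open subset of its domain. -/
def comorphism : Γ(Y, ⊤) ⟶ Γ(X, W) :=
  (restrictSpec g hW hWg).appTop ≫ (Scheme.ΓSpecIso Γ(X, W)).hom

theorem germ_top_stalkClosedPointTo {R : CommRingCat.{u}} [IsLocalRing R] (f : Spec R ⟶ Y) :
    Y.presheaf.germ ⊤ (f (IsLocalRing.closedPoint R)) trivial ≫ Scheme.stalkClosedPointTo f =
      f.appTop ≫ (Scheme.ΓSpecIso R).hom := by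
  refine (Scheme.germ_stalkClosedPointTo f ⊤ trivial).trans ?_
  exact congrArg (f.appTop ≫ ·) ((congrArg (· ≫ (Scheme.ΓSpecIso R).hom)
    ((Spec R).presheaf.map_id _)).trans (Category.id_comp _))

variable [IsIntegral Y] [Nonempty (⊤ : Y.Opens)] [g.toRationalMap.IsDominant]

/-- This identifies the function field extension in the separability hypothesis with the one induced
by the comorphism on a chart. -/
theorem germ_functionFieldMap :
    Y.germToFunctionField ⊤ ≫ functionFieldMap g.toRationalMap =
      comorphism g hW hWg ≫ X.germToFunctionField W := by
  have h1 : Y.germToFunctionField ⊤ ≫ functionFieldMap g.toRationalMap =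
      Y.presheaf.germ ⊤ _ trivial ≫ Scheme.stalkClosedPointTo g.fromFunctionField := by
    rw [functionFieldMap, TopCat.Presheaf.germ_stalkSpecializes_assoc]
    rfl
  have h2 := congrArg (fun f ↦ f.appTop ≫ (Scheme.ΓSpecIso X.functionField).hom)
    (fromFunctionField_eq_restrictSpec g hW hWg)
  refine h1.trans ((germ_top_stalkClosedPointTo _).trans (h2.trans ?_))
  rw [Scheme.Hom.comp_appTop, Category.assoc, Scheme.ΓSpecIso_naturality, comorphism,
    Category.assoc]

end FunctionField

/-! ### Coordinates on the affine target and values at rational points. -/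

section GlobalSections

variable (K : Type u) [Field K]

/-- The `K`-algebra structure on the global sections of a `K`-scheme. -/
abbrev globalAlgebra (Y : Scheme.{u}) [Y.Over (Spec (.of K))] : Algebra K Γ(Y, ⊤) :=
  ((Scheme.ΓSpecIso (.of K)).inv ≫ (Y ↘ Spec (.of K)).appTop).hom.toAlgebra

/-- The coordinate functions on a subscheme of affine space. -/
def coordinateFunction {K : Type u} [Field K] {n : ℕ} {Y : Scheme.{u}} (i : Y ⟶ affineSpace n K)
    (j : Fin n) : Γ(Y, ⊤) :=
  i.appTop (AffineSpace.coord (Spec (.of K)) ⟨j⟩)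

variable {K}

theorem aeval_coordinateFunction_surjective {n : ℕ} {Y : Scheme.{u}} [Y.Over (Spec (.of K))]
    (i : Y ⟶ affineSpace n K) [IsClosedImmersion i] [i.IsOver (Spec (.of K))] :
    letI := globalAlgebra K Y
    Function.Surjective (MvPolynomial.aeval (R := K) (coordinateFunction i)) := by
  let := globalAlgebra K Y
  let c : K →+* Γ(affineSpace n K, ⊤) :=
    ((Scheme.ΓSpecIso (.of K)).inv ≫ (affineSpace n K ↘ Spec (.of K)).appTop).hom
  have hev : Function.Surjective (MvPolynomial.eval₂Hom c (AffineSpace.coord (Spec (.of K)))) := by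
    have h := AffineSpace.SpecIso_hom_appTop (n := ULift.{u} (Fin n)) (.of K)
    have h' := (Iso.inv_comp_eq _).mpr h
    have hs : Function.Surjective ((Scheme.ΓSpecIso _).inv ≫
        (AffineSpace.SpecIso (ULift.{u} (Fin n)) (.of K)).hom.appTop) :=
      (IsClosedImmersion.isAffine_surjective_of_isAffine
        (AffineSpace.SpecIso (ULift.{u} (Fin n)) (.of K)).hom).2.comp
        (ConcreteCategory.bijective_of_isIso (Scheme.ΓSpecIso _).inv).2
    rw [h'] at hs
    exact hs
  have hi := (IsClosedImmersion.isAffine_surjective_of_isAffine i).2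
  have hcomp : ((MvPolynomial.aeval (R := K) (coordinateFunction i)).toRingHom.comp
      (MvPolynomial.rename (R := K) (ULift.down.{u} (α := Fin n))).toRingHom) =
      i.appTop.hom.comp (MvPolynomial.eval₂Hom c (AffineSpace.coord (Spec (.of K)))) := by
    refine MvPolynomial.ringHom_ext (fun r ↦ ?_) (fun j ↦ ?_)
    · have hover : (Scheme.ΓSpecIso (.of K)).inv ≫ (Y ↘ Spec (.of K)).appTop =
          ((Scheme.ΓSpecIso (.of K)).inv ≫ (affineSpace n K ↘ Spec (.of K)).appTop) ≫
            i.appTop := by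
        rw [Category.assoc, ← Scheme.Hom.comp_appTop, comp_over]
      suffices algebraMap K Γ(Y, ⊤) r = i.appTop.hom (c r) by simpa using this
      exact congrArg (fun f ↦ f.hom r) hover
    · simp [coordinateFunction]
  intro z
  obtain ⟨y, rfl⟩ := hi z
  obtain ⟨p, rfl⟩ := hev y
  exact ⟨_, DFunLike.congr_fun hcomp p⟩

end GlobalSections

section Values

variable {K : Type u} [Field K] {X Y : Scheme.{u}} [X.Over (Spec (.of K))] [Y.Over (Spec (.of K))]
  (g : X.PartialMap Y) {W : X.Opens} (hW : IsAffineOpen W) (hWg : W ≤ g.domain)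

theorem restrictSpec_over [g.IsOver (Spec (.of K))] :
    restrictSpec g hW hWg ≫ (Y ↘ Spec (.of K)) = hW.fromSpec ≫ (X ↘ Spec (.of K)) := by
  have h : g.hom ≫ (Y ↘ Spec (.of K)) = g.domain.ι ≫ (X ↘ Spec (.of K)) :=
    comp_over g.hom (Spec (.of K))
  rw [restrictSpec, Category.assoc, h, ← Category.assoc, IsOpenImmersion.lift_fac]

/-- The comorphism of a partial map of `K`-schemes is a homomorphism of `K`-algebras. -/
def comorphismAlgHom [g.IsOver (Spec (.of K))] :
    letI := globalAlgebra K Y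
    letI := sectionAlgebra K hW
    Γ(Y, ⊤) →ₐ[K] Γ(X, W) :=
  letI := globalAlgebra K Y
  letI := sectionAlgebra K hW
  { (comorphism g hW hWg).hom with
    commutes' := fun r ↦ by
      have h : ((Scheme.ΓSpecIso (.of K)).inv ≫ (Y ↘ Spec (.of K)).appTop) ≫
          comorphism g hW hWg = Spec.preimage (hW.fromSpec ≫ (X ↘ Spec (.of K))) := by
        rw [comorphism, Category.assoc, ← Scheme.Hom.comp_appTop_assoc, restrictSpec_over,
          Iso.inv_comp_eq, ← Scheme.ΓSpecIso_naturality, Spec.map_preimage]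
      exact congrArg (fun f ↦ f.hom r) h }

/-- A homomorphism `𝒪(W) ⟶ K` gives a value of a partial map which is defined on `W`. -/
theorem exists_mem_imageOfRationalPoints [g.IsOver (Spec (.of K))] {n : ℕ}
    (i : Y ⟶ affineSpace n K) :
    letI := sectionAlgebra K hW
    ∀ e : Γ(X, W) →ₐ[K] K, ∃ R ∈ imageOfRationalPoints K g.toRationalMap,
      ∀ j, coordinates (R.1 ≫ i) j = e (comorphism g hW hWg (coordinateFunction i j)) := by
  let := sectionAlgebra K hW
  intro e
  let s : Spec (.of K) ⟶ Spec Γ(X, W) := Spec.map (CommRingCat.ofHom e.toRingHom)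
  have hs : s ≫ hW.fromSpec ≫ (X ↘ Spec (.of K)) = 𝟙 _ := by
    rw [← specMap_sectionAlgebra, ← Spec.map_comp, ← CommRingCat.ofHom_comp]
    have : e.toRingHom.comp (algebraMap K Γ(X, W)) = RingHom.id K := e.comp_algebraMap
    rw [this]
    exact Spec.map_id _
  have hP : (s ≫ hW.fromSpec) ≫ (X ↘ Spec (.of K)) = 𝟙 _ := (Category.assoc _ _ _).trans hs
  have hR : (s ≫ restrictSpec g hW hWg) ≫ (Y ↘ Spec (.of K)) = 𝟙 _ := by
    rw [Category.assoc, restrictSpec_over]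
    exact hs
  refine ⟨⟨_, hR⟩, ⟨⟨_, hP⟩, g, s ≫ IsOpenImmersion.lift g.domain.ι hW.fromSpec
    (range_fromSpec_subset_range_ι g hW hWg), rfl, ?_, ?_⟩, fun j ↦ ?_⟩
  · rw [Category.assoc, IsOpenImmersion.lift_fac]
  · rw [Category.assoc]
    rfl
  · have h : i.appTop ≫ (restrictSpec g hW hWg).appTop ≫ s.appTop ≫ (Scheme.ΓSpecIso (.of K)).hom =
        i.appTop ≫ comorphism g hW hWg ≫ CommRingCat.ofHom e.toRingHom := by
      rw [Scheme.ΓSpecIso_naturality, comorphism, Category.assoc]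
    have h' : ((s ≫ restrictSpec g hW hWg) ≫ i).appTop ≫ (Scheme.ΓSpecIso (.of K)).hom =
        i.appTop ≫ comorphism g hW hWg ≫ CommRingCat.ofHom e.toRingHom := by
      rw [← h, Scheme.Hom.comp_appTop, Scheme.Hom.comp_appTop, Category.assoc, Category.assoc]
    exact congrArg (fun f ↦ f.hom (AffineSpace.coord (Spec (.of K)) ⟨j⟩)) h'

end Values

end AmpleFields

end

/-! ### The main theorem. -/

theorem mainTheorem1 (K : Type u) [Field K] (hK : AmpleFields.IsAmple K)
    (C : Scheme.{u}) [C.Over (Spec (.of K))] [AmpleFields.IsCurve K C]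
    (hC : ∃ P : AmpleFields.RationalPoint K C, P.IsSimple)
    (n : ℕ) (C' : Scheme.{u}) [C'.Over (Spec (.of K))] [AmpleFields.IsCurve K C']
    (i : C' ⟶ AmpleFields.affineSpace n K) [IsClosedImmersion i] [i.IsOver (Spec (.of K))]
    (φ : Scheme.RationalMap C C') [φ.IsOver (Spec (.of K))] [φ.IsDominant]
    (hφ : AmpleFields.IsSeparableMap K φ)
    (K₀ : Subfield K) (hK₀ : K₀ ≠ ⊤) :
    Cardinal.mk
        ↥((fun R : AmpleFields.RationalPoint K C' => AmpleFields.coordinates (R.1 ≫ i)) ''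
            AmpleFields.imageOfRationalPoints K φ \ {x : Fin n → K | ∀ j, x j ∈ K₀}) =
      Cardinal.mk K := by
  open AmpleFields Cardinal in
  have := IsCurve.isIntegral K C
  have := IsCurve.isIntegral K C'
  obtain ⟨P, hP⟩ := hC
  obtain ⟨g, hg, rfl⟩ := φ.exists_partialMap_over (Spec (.of K))
  have hne : (g.domain : Set C).Nonempty := g.dense_domain.nonempty
  obtain ⟨W, hW, hWne, hWg, hsm, hdim, hinf⟩ := exists_affine_chart hK P hP g.domain hne
  let := sectionAlgebra K hW
  let := globalAlgebra K C'
  have : Nonempty (⊤ : C'.Opens) := ⟨⟨genericPoint C', trivial⟩⟩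
  have hC' : IsAffine C' := (IsClosedImmersion.isAffine_surjective_of_isAffine i).1
  have := functionField_isFractionRing_of_isAffineOpen C W hW
  have := functionField_isFractionRing_of_isAffineOpen C' ⊤ (isAffineOpen_top C')
  let : Algebra C'.functionField C.functionField :=
    (functionFieldMap g.toRationalMap).hom.toAlgebra
  have : Algebra.IsSeparable C'.functionField C.functionField := hφ
  obtain ⟨j, hj⟩ := exists_mk_le_mk_values_comp_diff
    (E := C'.functionField) (F := C.functionField) hK (comorphismAlgHom g hW hWg)
    (fun b ↦ congrArg (fun f ↦ f.hom b) (germ_functionFieldMap g hW hWg)) (coordinateFunction i)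
    (aeval_coordinateFunction_surjective i) K₀ hK₀
  have hinfK : Infinite K := infinite_of_infinite_algHom (S := Γ(C, W))
  refine le_antisymm ?_ (hj.trans ?_)
  -- Upper bound: `#(Kⁿ) ≤ #K` for infinite `K`.
  · refine (mk_set_le _).trans ?_
    rw [mk_arrow]
    simpa using power_nat_le (n := n) (aleph0_le_mk K)
  -- Lower bound: project to the `j`-th coordinate; a point whose `j`-th coordinate avoids `K₀` is
  -- not in `K₀ⁿ`.
  · refine le_trans (mk_le_mk_of_subset ?_) (mk_image_le (f := fun x : Fin n → K ↦ x j))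
    rintro _ ⟨⟨e, rfl⟩, he⟩
    obtain ⟨R, hR, hRe⟩ := exists_mem_imageOfRationalPoints g hW hWg i e
    exact ⟨_, ⟨⟨R, hR, rfl⟩, fun h ↦ he ((congrArg (· ∈ K₀) (hRe j)).mp (h j))⟩, hRe j⟩
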